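/- Let $\mathbb K\in\{\mathbb R,\mathbb C\}$ and let $\Omega\subseteq\mathbb R^n$ be a (non-empty) connected bounded open set. All function spaces consist of $\mathbb K$-valued functions. Let $H^1_0(\Omega)$ be the closure of $C_c^\infty(\Omega)$ in the Sobolev space $H^1(\Omega)$, and let $H^{-1}(\Omega)$ be the anti-dual of $H^1_0(\Omega)$ (the continuous conjugate linear functionals), where $f\in L_2(\Omega)$ is identified with $u\mapsto\int_\Omega f\,\overline u\,dx$. For $f\in L_2(\Omega)$ the gradient $\operatorname{grad} f\in H^{-1}(\Omega)^n$ is given by $\langle(\operatorname{grad} f)_j,u\rangle=-\int_\Omega f\,\overline{\partial_j u}\,dx$ $(u\in H^1_0(\Omega))$. A distribution $T\in\mathcal D'(\Omega)$ belongs to $H^{-1}(\Omega)$ if there is $g\in H^{-1}(\Omega)$ with $T(\varphi)=\langle g,\varphi\rangle$ for all real-valued test functions $\varphi$ on $\Omega$. Then the following two properties of $\Omega$ are equivalent. $(\mathrm H_c)$ For every $g=(g_1,\dots,g_n)\in H^{-1}(\Omega)^n$ such that $\sum_{j=1}^n\langle g_j,\varphi_j\rangle=0$ for all $\varphi\in C_c^\infty(\Omega;\mathbb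 K^n)$ with $\operatorname{div}\varphi=0$, there exists $f\in L_2(\Omega)$ with $g=\operatorname{grad} f$. (J. L. Lions property) For every distribution $F\in\mathcal D'(\Omega)$ with $\partial_jF\in H^{-1}(\Omega)$ for $j=1,\dots,n$ there exists $f\in L_2(\Omega)$ with $F=f$ as distributions, i.e. $F(\varphi)=\int_\Omega f\varphi\,dx$ for all real-valued test functions $\varphi$ on $\Omega$. -/

import Mathlib

noncomputable section

namespace LionsDeRham

open MeasureTheory TopologicalSpace
open scoped Distributions LineDeriv

/-- `ℝⁿ` with its Euclidean norm. -/
abbrev Rn (n : ℕ) : Type := EuclideanSpace ℝ (Fin n)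

variable {n : ℕ} {𝕜 : Type*} [RCLike 𝕜] {Ω : Opens (Rn n)}

/-- The `j`-th standard unit vector of `ℝⁿ`. -/
abbrev stdVec (j : Fin n) : Rn n := EuclideanSpace.single j (1 : ℝ)

/-- `L₂(Ω)`, with values in `𝕜 = ℝ` or `𝕜 = ℂ` and Lebesgue measure on `Ω`. -/
abbrev LTwo (Ω : Opens (Rn n)) (𝕜 : Type*) [RCLike 𝕜] : Type _ :=
  Lp 𝕜 2 (volume.restrict (Ω : Set (Rn n)))

theorem testFunction_memLp (φ : 𝓓(Ω, 𝕜)) :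
    MemLp φ 2 (volume.restrict (Ω : Set (Rn n))) :=
  φ.continuous.memLp_of_hasCompactSupport φ.hasCompactSupport

/-- A test function as an element of `L₂(Ω)`. -/
def testToLTwo (Ω : Opens (Rn n)) (𝕜 : Type*) [RCLike 𝕜] : 𝓓(Ω, 𝕜) →ₗ[𝕜] LTwo Ω 𝕜 where
  toFun φ := (testFunction_memLp φ).toLp φ
  map_add' φ ψ := MemLp.toLp_add (testFunction_memLp φ) (testFunction_memLp ψ)
  map_smul' c φ := MemLp.toLp_const_smul c (testFunction_memLp φ)

/-- `v` is the weak derivative `∂ⱼu` on `Ω`, for `u, v ∈ L₂(Ω)`: for all test functions `φ`,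
`∫_Ω u · conj(∂ⱼφ) = - ∫_Ω v · conj φ`, written with the inner product of `L₂(Ω)`
(which is conjugate linear in the first argument). -/
def IsWeakDeriv (j : Fin n) (u v : LTwo Ω 𝕜) : Prop :=
  ∀ φ : 𝓓(Ω, 𝕜),
    inner 𝕜 (testToLTwo Ω 𝕜 (∂_{stdVec j} φ)) u = - inner 𝕜 (testToLTwo Ω 𝕜 φ) v

/-- The Hilbert space `L₂(Ω) × L₂(Ω)ⁿ`. -/
abbrev LTwoProd (Ω : Opens (Rn n)) (𝕜 : Type*) [RCLike 𝕜] : Type _ :=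
  WithLp 2 (LTwo Ω 𝕜 × PiLp 2 (fun _ : Fin n => LTwo Ω 𝕜))

/-- The Sobolev space `H¹(Ω)` of those `u ∈ L₂(Ω)` whose first order weak derivatives belong to
`L₂(Ω)`, realised as the set of pairs `(u, ∇u)`, so that the norm is
`(‖u‖² + ∑ⱼ ‖∂ⱼu‖²)^{1/2}`. -/
def HOne (Ω : Opens (Rn n)) (𝕜 : Type*) [RCLike 𝕜] : Submodule 𝕜 (LTwoProd Ω 𝕜) where
  carrier := {p | ∀ j, IsWeakDeriv j p.fst (p.snd j)}
  zero_mem' := by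
    intro j φ
    simp
  add_mem' := by
    intro p q hp hq j φ
    have h1 := hp j φ
    have h2 := hq j φ
    simp only [WithLp.add_fst, WithLp.add_snd, PiLp.add_apply, inner_add_right, h1, h2]
    ring
  smul_mem' := by
    intro c p hp j φ
    have h1 := hp j φ
    simp only [WithLp.smul_fst, WithLp.smul_snd, PiLp.smul_apply, inner_smul_right, h1]
    ring

/-- The weak derivative `∂ⱼ : H¹(Ω) → L₂(Ω)`. -/
def weakDeriv (Ω : Opens (Rn n)) (𝕜 : Type*) [RCLike 𝕜] (j : Fin n) :
    HOne Ω 𝕜 →L[𝕜] LTwo Ω 𝕜 :=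
  (PiLp.proj 2 (fun _ : Fin n => LTwo Ω 𝕜) j).comp
    ((WithLp.sndL 2 𝕜 (LTwo Ω 𝕜) (PiLp 2 (fun _ : Fin n => LTwo Ω 𝕜))).comp (HOne Ω 𝕜).subtypeL)

theorem inner_testToLTwo (φ ψ : 𝓓(Ω, 𝕜)) :
    inner 𝕜 (testToLTwo Ω 𝕜 φ) (testToLTwo Ω 𝕜 ψ) = ∫ x, star (φ x) * ψ x := by
  have h1 : inner 𝕜 (testToLTwo Ω 𝕜 φ) (testToLTwo Ω 𝕜 ψ)
      = ∫ x in (Ω : Set (Rn n)), star (φ x) * ψ x := by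
    rw [L2.inner_def]
    refine integral_congr_ae ?_
    filter_upwards [(testFunction_memLp φ).coeFn_toLp, (testFunction_memLp ψ).coeFn_toLp]
      with x hx hy
    change inner 𝕜 (((testFunction_memLp φ).toLp φ : LTwo Ω 𝕜) x)
      (((testFunction_memLp ψ).toLp ψ : LTwo Ω 𝕜) x) = _
    rw [hx, hy, RCLike.inner_apply, mul_comm]
    rfl
  rw [h1]
  refine setIntegral_eq_integral_of_forall_compl_eq_zero fun x hx => ?_
  rw [image_eq_zero_of_notMem_tsupport fun h => hx (ψ.tsupport_subset h), mul_zero]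

theorem isWeakDeriv_test (j : Fin n) (φ : 𝓓(Ω, 𝕜)) :
    IsWeakDeriv j (testToLTwo Ω 𝕜 φ) (testToLTwo Ω 𝕜 (∂_{stdVec j} φ)) := by
  intro ψ
  rw [inner_testToLTwo, inner_testToLTwo]
  have hint : ∀ a b : 𝓓(Ω, 𝕜), Integrable (fun x => star (a x) * b x) := fun a b =>
    Continuous.integrable_of_hasCompactSupport (by fun_prop) b.hasCompactSupport.mul_left
  have hd : ∀ (a : 𝓓(Ω, 𝕜)) (x : Rn n),
      HasLineDerivAt ℝ a ((∂_{stdVec j} a : 𝓓(Ω, 𝕜)) x) x (stdVec j) := fun a x =>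
    ((a.contDiff.differentiable (by simp)) x).hasFDerivAt.hasLineDerivAt (stdVec j)
  have key := integral_bilinear_hasLineDerivAt_right_eq_neg_left_of_integrable
    (μ := (volume : Measure (Rn n))) (f := ψ) (f' := (∂_{stdVec j} ψ : 𝓓(Ω, 𝕜)))
    (g := φ) (g' := (∂_{stdVec j} φ : 𝓓(Ω, 𝕜))) (v := stdVec j)
    (B := (ContinuousLinearMap.mul ℝ 𝕜).comp (RCLike.conjCLE : 𝕜 ≃L[ℝ] 𝕜).toContinuousLinearMap)
    (hint _ _) (hint _ _) (hint _ _) (fun x _ => hd ψ x) (fun x _ => hd φ x)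
  have key' : ∫ x, star (ψ x) * (∂_{stdVec j} φ : 𝓓(Ω, 𝕜)) x
      = - ∫ x, star ((∂_{stdVec j} ψ : 𝓓(Ω, 𝕜)) x) * φ x := key
  rw [key', neg_neg]

/-- A test function `φ` as an element `(φ, ∇φ)` of `H¹(Ω)`. -/
def testToHOne (Ω : Opens (Rn n)) (𝕜 : Type*) [RCLike 𝕜] : 𝓓(Ω, 𝕜) →ₗ[𝕜] HOne Ω 𝕜 where
  toFun φ := ⟨WithLp.toLp 2 (testToLTwo Ω 𝕜 φ,
    WithLp.toLp 2 fun j => testToLTwo Ω 𝕜 (∂_{stdVec j} φ)), fun j => isWeakDeriv_test j φ⟩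
  map_add' φ ψ := by
    simp only [LineDeriv.lineDerivOp_add, map_add]
    rfl
  map_smul' c φ := by
    simp only [LineDeriv.lineDerivOp_smul, map_smul]
    rfl

/-- `H¹₀(Ω)`, the closure of `C_c^∞(Ω)` in `H¹(Ω)`. -/
def HOneZero (Ω : Opens (Rn n)) (𝕜 : Type*) [RCLike 𝕜] : Submodule 𝕜 (HOne Ω 𝕜) :=
  (LinearMap.range (testToHOne Ω 𝕜)).topologicalClosure

/-- A test function as an element of `H¹₀(Ω)`. -/
def testToHOneZero (Ω : Opens (Rn n)) (𝕜 : Type*) [RCLike 𝕜] :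
    𝓓(Ω, 𝕜) →ₗ[𝕜] HOneZero Ω 𝕜 :=
  (testToHOne Ω 𝕜).codRestrict (HOneZero Ω 𝕜) fun φ =>
    Submodule.le_topologicalClosure _ (LinearMap.mem_range_self _ φ)

/-- `H⁻¹(Ω)`, the anti-dual of `H¹₀(Ω)`: the continuous conjugate linear functionals. -/
abbrev HNegOne (Ω : Opens (Rn n)) (𝕜 : Type*) [RCLike 𝕜] : Type _ :=
  HOneZero Ω 𝕜 →L⋆[𝕜] 𝕜

/-- The gradient `grad : L₂(Ω) → H⁻¹(Ω)ⁿ`, `⟨(grad f)ⱼ, u⟩ = - ∫_Ω f · conj(∂ⱼu)` for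
`u ∈ H¹₀(Ω)`. -/
def grad (f : LTwo Ω 𝕜) : Fin n → HNegOne Ω 𝕜 := fun j =>
  -((innerSLFlip 𝕜 f).comp ((weakDeriv Ω 𝕜 j).comp (HOneZero Ω 𝕜).subtypeL))

/-- The polar `V° = {g ∈ H⁻¹(Ω)ⁿ : ⟨g, φ⟩ = 0 for all φ ∈ V}` of `V ⊆ H¹₀(Ω; 𝕜ⁿ)`. -/
def polar (V : Set (Fin n → HOneZero Ω 𝕜)) : Set (Fin n → HNegOne Ω 𝕜) :=
  {g | ∀ φ ∈ V, ∑ j, g j (φ j) = 0}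

/-- `C^∞_{c,σ}(Ω; 𝕜ⁿ)`, the divergence free fields of test functions on `Ω`, as a subset of
`H¹₀(Ω; 𝕜ⁿ)`. -/
def divFreeTest (Ω : Opens (Rn n)) (𝕜 : Type*) [RCLike 𝕜] : Set (Fin n → HOneZero Ω 𝕜) :=
  {u | ∃ φ : Fin n → 𝓓(Ω, 𝕜),
    ∑ j, ∂_{stdVec j} (φ j) = 0 ∧ ∀ j, u j = testToHOneZero Ω 𝕜 (φ j)}

/-- Property `(H_c)`: every `g ∈ C^∞_{c,σ}(Ω; 𝕜ⁿ)°` is the gradient of some `f ∈ L₂(Ω)`. -/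
def PropHc (Ω : Opens (Rn n)) (𝕜 : Type*) [RCLike 𝕜] : Prop :=
  ∀ g ∈ polar (divFreeTest Ω 𝕜), ∃ f : LTwo Ω 𝕜, g = grad f

/-- A real-valued test function regarded as a `𝕜`-valued one. -/
def realTest (𝕜 : Type*) [RCLike 𝕜] (φ : 𝓓(Ω, ℝ)) : 𝓓(Ω, 𝕜) :=
  TestFunction.postcompCLM (RCLike.ofRealCLM : ℝ →L[ℝ] 𝕜) φ

/-- The distribution `F` belongs to `H⁻¹(Ω)`, being given on test functions by a functional
`g ∈ H⁻¹(Ω)`. (As everywhere in Mathlib, `𝕜`-valued distributions are tested against real-valued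
test functions; this determines their values on `𝕜`-valued ones.) -/
def MemHNegOne (F : 𝓓'(Ω, 𝕜)) : Prop :=
  ∃ g : HNegOne Ω 𝕜, ∀ φ : 𝓓(Ω, ℝ), F φ = g (testToHOneZero Ω 𝕜 (realTest 𝕜 φ))

/-- `F = f` as distributions, for `f ∈ L₂(Ω)`. -/
def EqAsDistribution (F : 𝓓'(Ω, 𝕜)) (f : LTwo Ω 𝕜) : Prop :=
  ∀ φ : 𝓓(Ω, ℝ), F φ = ∫ x in (Ω : Set (Rn n)), φ x • f x

/-- The conclusion of J. L. Lions' lemma: every distribution on `Ω` with gradient in `H⁻¹(Ω)ⁿ` is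
given by a function in `L₂(Ω)`. -/
def LionsProperty (Ω : Opens (Rn n)) (𝕜 : Type*) [RCLike 𝕜] : Prop :=
  ∀ F : 𝓓'(Ω, 𝕜), (∀ j : Fin n, MemHNegOne (∂_{stdVec j} F)) →
    ∃ f : LTwo Ω 𝕜, EqAsDistribution F f

end LionsDeRham

end

/-! Both properties concern functionals on test fields, linked by duality with the divergence: for a
distribution `F` with `∂ⱼF = gⱼ` one has `∑ gⱼ(φⱼ) = -F(div φ)`. The bridge is a distributional de
Rham theorem: a field `g` in H⁻¹ that vanishes on divergence free test fields is the gradient of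
some distribution.

Everything rests on `exists_local_divergence`: near a point of `Ω`, `ψ - (∫ψ)ρ` is the divergence of
a test field whose C¹ bounds are controlled by those of `ψ`. The field is explicit. Averaging `y a(x
- ty)` over `t ∈ [0,1]` and over `y` with weight `w` gives a field with divergence `(∫w) a - w * a`;
taking `(w, a)` to be `(ρ, ψ)` and then `(ψ, ρ)`, up to translation, and subtracting cancels the
convolutions.

Lions implies (H_c): `-g` factors algebraically through the divergence and extends linearly to all
test functions. By the local lemma any such extension is locally of order at most one, hence a
distribution `F` with gradient `g`. Lions' property provides `f` with `F = f`, and density of test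
functions gives `g = grad f`.

(H_c) implies Lions: the gradient of `F` annihilates divergence free fields, so it equals `grad f`.
Then `F - f` kills divergences, so by the local lemma and connectedness it is a constant, which lies
in L₂ since `Ω` is bounded. -/

noncomputable section

namespace LionsDeRham

open MeasureTheory TopologicalSpace
open scoped Distributions LineDeriv ContDiff

/-! ### Weighted averages of translates: smoothness, bounds, supports. -/

section AveragedTranslates

variable {n : ℕ} {X : Type*} [MeasurableSpace X] {μ : Measure X} {w : X → ℝ} {s : X → Rn n}

/-- The average of the translates `a (x - s p)` of a function `a`, with weight `w p`. -/
def averageTranslates {E : Type*} [NormedAddCommGroup E] [NormedSpace ℝ E]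
    (μ : Measure X) (w : X → ℝ) (s : X → Rn n) (a : Rn n → E) (x : Rn n) : E :=
  ∫ p, w p • a (x - s p) ∂μ

theorem integrable_translates {E : Type*} [NormedAddCommGroup E] [NormedSpace ℝ E]
    (hw : Integrable w μ) (hs : Measurable s) {a : Rn n → E} (ha : Continuous a)
    (hac : HasCompactSupport a) (x : Rn n) : Integrable (fun p => w p • a (x - s p)) μ := by
  obtain ⟨C, hC⟩ := ha.bounded_above_of_compact_support hac
  refine hw.smul_bdd C ?_ (Filter.Eventually.of_forall fun p => hC _)
  exact (ha.stronglyMeasurable_of_hasCompactSupport hac).comp_measurable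
    (measurable_const.sub hs) |>.aestronglyMeasurable

/-- Differentiation under the integral puts the derivative on `a` alone, so `w` need only be
integrable. This is why the later C¹ bounds involve no derivative of the weight. -/
theorem hasFDerivAt_averageTranslates {E : Type*} [NormedAddCommGroup E] [NormedSpace ℝ E]
    (hw : Integrable w μ) (hs : Measurable s) {a : Rn n → E} (ha : ContDiff ℝ 1 a)
    (hac : HasCompactSupport a) (x : Rn n) :
    HasFDerivAt (averageTranslates μ w s a) (averageTranslates μ w s (fderiv ℝ a) x) x := by
  have hdc : Continuous (fderiv ℝ a) := ha.continuous_fderiv one_ne_zero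
  obtain ⟨C, hC⟩ := hdc.bounded_above_of_compact_support (hac.fderiv ℝ)
  refine hasFDerivAt_integral_of_dominated_of_fderiv_le (𝕜 := ℝ) (bound := fun p => ‖w p‖ * C)
    (F := fun y p => w p • a (y - s p)) (F' := fun y p => w p • fderiv ℝ a (y - s p))
    (s := Set.univ) Filter.univ_mem ?_ ?_ ?_ ?_ ?_ ?_
  · exact Filter.Eventually.of_forall fun y =>
      (integrable_translates hw hs ha.continuous hac y).aestronglyMeasurable
  · exact integrable_translates hw hs ha.continuous hac x
  · exact (integrable_translates hw hs hdc (hac.fderiv ℝ) x).aestronglyMeasurable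
  · refine Filter.Eventually.of_forall fun p y _ => ?_
    rw [norm_smul]
    exact mul_le_mul_of_nonneg_left (hC _) (norm_nonneg _)
  · exact hw.norm.mul_const C
  · refine Filter.Eventually.of_forall fun p y _ => ?_
    have h := ((ha.differentiable one_ne_zero) (y - s p)).hasFDerivAt.comp y
      ((hasFDerivAt_id y).sub_const (s p))
    exact h.const_smul (w p)

theorem fderiv_averageTranslates {E : Type*} [NormedAddCommGroup E] [NormedSpace ℝ E]
    (hw : Integrable w μ) (hs : Measurable s) {a : Rn n → E} (ha : ContDiff ℝ 1 a)
    (hac : HasCompactSupport a) :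
    fderiv ℝ (averageTranslates μ w s a) = averageTranslates μ w s (fderiv ℝ a) :=
  funext fun x => (hasFDerivAt_averageTranslates hw hs ha hac x).fderiv

/-- The derivative is again an average of translates, of `fderiv ℝ a`; the induction therefore runs
over all target spaces at once. -/
theorem contDiff_averageTranslates_nat (hw : Integrable w μ) (hs : Measurable s) (m : ℕ) :
    ∀ {E : Type} [NormedAddCommGroup E] [NormedSpace ℝ E] {a : Rn n → E},
      ContDiff ℝ ∞ a → HasCompactSupport a → ContDiff ℝ m (averageTranslates μ w s a) := by
  induction m with
  | zero =>
    intro E _ _ a ha hac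
    refine contDiff_zero.2 (continuous_iff_continuousAt.2 fun x => ?_)
    exact (hasFDerivAt_averageTranslates hw hs (ha.of_le (by simp)) hac x).continuousAt
  | succ m ih =>
    intro E _ _ a ha hac
    have ha1 : ContDiff ℝ 1 a := ha.of_le (by simp)
    rw [Nat.cast_add, Nat.cast_one, contDiff_succ_iff_fderiv]
    refine ⟨fun x => (hasFDerivAt_averageTranslates hw hs ha1 hac x).differentiableAt,
      by simp, ?_⟩
    rw [fderiv_averageTranslates hw hs ha1 hac]
    exact ih (ha.fderiv_right (by simp)) (hac.fderiv ℝ)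

theorem contDiff_averageTranslates {E : Type} [NormedAddCommGroup E] [NormedSpace ℝ E]
    (hw : Integrable w μ) (hs : Measurable s) {a : Rn n → E} (ha : ContDiff ℝ ∞ a)
    (hac : HasCompactSupport a) : ContDiff ℝ ∞ (averageTranslates μ w s a) :=
  contDiff_infty.2 fun m => contDiff_averageTranslates_nat hw hs m ha hac

theorem norm_averageTranslates_le [IsFiniteMeasure μ] {E : Type*} [NormedAddCommGroup E]
    [NormedSpace ℝ E] {a : Rn n → E} {W A : ℝ}
    (hW : ∀ᵐ p ∂μ, ‖w p‖ ≤ W) (hA : ∀ y, ‖a y‖ ≤ A) (x : Rn n) :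
    ‖averageTranslates μ w s a x‖ ≤ W * A * μ.real Set.univ := by
  refine norm_integral_le_of_norm_le_const (hW.mono fun p hp => ?_)
  rw [norm_smul]
  exact mul_le_mul hp (hA _) (norm_nonneg _) ((norm_nonneg _).trans hp)

theorem support_averageTranslates_subset {E : Type*} [NormedAddCommGroup E]
    [NormedSpace ℝ E] {a : Rn n → E} {K : Set (Rn n)} (h : ∀ᵐ p ∂μ, ∀ y, a y ≠ 0 → y + s p ∈ K) :
    Function.support (averageTranslates μ w s a) ⊆ K := by
  intro x hx
  by_contra hxK
  refine hx (integral_eq_zero_of_ae (h.mono fun p hp => ?_))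
  have : a (x - s p) = 0 := by
    by_contra h0
    exact hxK (by simpa using hp _ h0)
  simp [this]

end AveragedTranslates

/-! ### An explicit field with divergence `(∫w) a - w * a`. -/

section Potential

variable {n : ℕ}

/-- The measure `dy dt` on `{|y| ≤ r} × [0, 1]`. -/
def segmentMeasure (n : ℕ) (r : ℝ) : Measure (Rn n × ℝ) :=
  (volume.restrict (Metric.closedBall (0 : Rn n) r)).prod (volume.restrict (Set.Icc (0 : ℝ) 1))

instance (r : ℝ) : IsFiniteMeasure (segmentMeasure n r) := by
  have : IsFiniteMeasure ((volume : Measure (Rn n)).restrict (Metric.closedBall 0 r)) :=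
    isFiniteMeasure_restrict.2 measure_closedBall_lt_top.ne
  unfold segmentMeasure
  infer_instance

theorem ae_segmentMeasure (r : ℝ) :
    ∀ᵐ p ∂segmentMeasure n r, ‖p.1‖ ≤ r ∧ ‖p.2‖ ≤ 1 := by
  have : IsFiniteMeasure ((volume : Measure (Rn n)).restrict (Metric.closedBall 0 r)) :=
    isFiniteMeasure_restrict.2 measure_closedBall_lt_top.ne
  have h1 : ∀ᵐ p ∂segmentMeasure n r, p.1 ∈ Metric.closedBall (0 : Rn n) r :=
    Measure.quasiMeasurePreserving_fst.ae (ae_restrict_mem Metric.isClosed_closedBall.measurableSet)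
  have h2 : ∀ᵐ p ∂segmentMeasure n r, p.2 ∈ Set.Icc (0 : ℝ) 1 :=
    Measure.quasiMeasurePreserving_snd.ae (ae_restrict_mem measurableSet_Icc)
  filter_upwards [h1, h2] with p hp hq
  refine ⟨by simpa using hp, ?_⟩
  rw [Real.norm_eq_abs, abs_le]
  exact ⟨by linarith [hq.1], hq.2⟩

/-- The vector field `x ↦ ∫ w(y) ∫₀¹ y a(x - t y) dt dy`, `y` ranging over `|y| ≤ r`. -/
def segmentField (r : ℝ) (w a : Rn n → ℝ) (j : Fin n) : Rn n → ℝ :=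
  averageTranslates (segmentMeasure n r) (fun p => w p.1 * p.1 j) (fun p => p.2 • p.1) a

theorem norm_weight_le {r W : ℝ} {w : Rn n → ℝ} (hw : ∀ y, ‖w y‖ ≤ W) (j : Fin n) :
    ∀ᵐ p ∂segmentMeasure n r, ‖w p.1 * p.1 j‖ ≤ W * r := by
  filter_upwards [ae_segmentMeasure r] with p hp
  rw [norm_mul]
  exact mul_le_mul (hw _) ((PiLp.norm_apply_le p.1 j).trans hp.1) (norm_nonneg _)
    ((norm_nonneg _).trans (hw p.1))

theorem integrable_weight (r : ℝ) {w : Rn n → ℝ} (hw : Continuous w)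
    (hwc : HasCompactSupport w) (j : Fin n) :
    Integrable (fun p : Rn n × ℝ => w p.1 * p.1 j) (segmentMeasure n r) := by
  obtain ⟨W, hW⟩ := hw.bounded_above_of_compact_support hwc
  refine Integrable.of_bound (Measurable.aestronglyMeasurable ?_) (W * r) (norm_weight_le hW j)
  fun_prop

theorem measurable_segment : Measurable (fun p : Rn n × ℝ => p.2 • p.1) := by fun_prop

theorem contDiff_segmentField (r : ℝ) {w a : Rn n → ℝ} (hw : Continuous w)
    (hwc : HasCompactSupport w) (ha : ContDiff ℝ ∞ a) (hac : HasCompactSupport a) (j : Fin n) :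
    ContDiff ℝ ∞ (segmentField r w a j) :=
  contDiff_averageTranslates (integrable_weight r hw hwc j) measurable_segment ha hac

theorem support_segmentField_subset {r q : ℝ} {w a : Rn n → ℝ} {x₀ : Rn n}
    (ha : Function.support a ⊆ Metric.closedBall x₀ q) (j : Fin n) :
    Function.support (segmentField r w a j) ⊆ Metric.closedBall x₀ (q + r) := by
  refine support_averageTranslates_subset ?_
  filter_upwards [ae_segmentMeasure r] with p hp y hy
  have h1 := mem_closedBall_iff_norm.1 (ha hy)
  rw [mem_closedBall_iff_norm, add_sub_right_comm]
  refine (norm_add_le _ _).trans (add_le_add h1 ?_)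
  rw [norm_smul]
  calc ‖p.2‖ * ‖p.1‖ ≤ 1 * ‖p.1‖ := by gcongr; exact hp.2
    _ ≤ r := by rw [one_mul]; exact hp.1

theorem norm_segmentField_le {r W A : ℝ} {w a : Rn n → ℝ}
    (hW : ∀ y, ‖w y‖ ≤ W) (hA : ∀ y, ‖a y‖ ≤ A) (j : Fin n) (x : Rn n) :
    ‖segmentField r w a j x‖ ≤ W * r * A * (segmentMeasure n r).real Set.univ :=
  norm_averageTranslates_le (norm_weight_le hW j) hA x

theorem norm_fderiv_segmentField_le {r W A : ℝ} {w a : Rn n → ℝ} (hw : Continuous w)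
    (hwc : HasCompactSupport w) (ha : ContDiff ℝ 1 a) (hac : HasCompactSupport a)
    (hW : ∀ y, ‖w y‖ ≤ W) (hA : ∀ y, ‖fderiv ℝ a y‖ ≤ A) (j : Fin n) (x : Rn n) :
    ‖fderiv ℝ (segmentField r w a j) x‖ ≤ W * r * A * (segmentMeasure n r).real Set.univ := by
  unfold segmentField
  rw [fderiv_averageTranslates (integrable_weight r hw hwc j) measurable_segment ha hac]
  exact norm_averageTranslates_le (norm_weight_le hW j) hA x

theorem integral_fderiv_segment {a : Rn n → ℝ} (ha : ContDiff ℝ 1 a) (x y : Rn n) :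
    ∫ t in Set.Icc (0 : ℝ) 1, fderiv ℝ a (x - t • y) y = a x - a (x - y) := by
  have hd : ∀ t : ℝ, HasDerivAt (fun t : ℝ => - a (x - t • y)) (fderiv ℝ a (x - t • y) y) t := by
    intro t
    have h1 : HasDerivAt (fun t : ℝ => x - t • y) (-y) t := by
      simpa using ((hasDerivAt_id t).smul_const y).const_sub x
    have h2 := (((ha.differentiable one_ne_zero) (x - t • y)).hasFDerivAt.comp_hasDerivAt t h1).neg
    rw [map_neg, neg_neg] at h2
    exact h2
  have hc : Continuous fun t : ℝ => fderiv ℝ a (x - t • y) y :=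
    ((ha.continuous_fderiv one_ne_zero).comp (by fun_prop)).clm_apply continuous_const
  rw [integral_Icc_eq_integral_Ioc, ← intervalIntegral.integral_of_le zero_le_one,
    intervalIntegral.integral_eq_sub_of_hasDerivAt (fun t _ => hd t)
      (hc.intervalIntegrable _ _)]
  simp
  ring

/-- The weights `yⱼ` assemble the partial derivatives into the derivative of `a` in direction `y`.
By the fundamental theorem of calculus its integral over the segment from `x - y` to `x` is `a x - a
(x - y)`; it remains to integrate against `w`, whose support lies in the ball. -/
theorem sum_fderiv_segmentField {r : ℝ} {w a : Rn n → ℝ} (hw : Continuous w)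
    (hwc : HasCompactSupport w) (hwr : Function.support w ⊆ Metric.closedBall 0 r)
    (ha : ContDiff ℝ 1 a) (hac : HasCompactSupport a) (x : Rn n) :
    ∑ j, fderiv ℝ (segmentField r w a j) x (stdVec j)
      = (∫ y, w y) * a x - ∫ y, w y * a (x - y) := by
  have hfin : IsFiniteMeasure ((volume : Measure (Rn n)).restrict (Metric.closedBall 0 r)) :=
    isFiniteMeasure_restrict.2 measure_closedBall_lt_top.ne
  have hdc : Continuous (fderiv ℝ a) := ha.continuous_fderiv one_ne_zero
  have hint := fun j => integrable_translates (integrable_weight r hw hwc j) measurable_segment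
    hdc (hac.fderiv ℝ) x
  have hint' : ∀ j, Integrable (fun p : Rn n × ℝ =>
      ((w p.1 * p.1 j) • fderiv ℝ a (x - p.2 • p.1)) (stdVec j)) (segmentMeasure n r) :=
    fun j => (ContinuousLinearMap.apply ℝ ℝ (stdVec j)).integrable_comp (hint j)
  have hsum : ∀ p : Rn n × ℝ, ∑ j, ((w p.1 * p.1 j) • fderiv ℝ a (x - p.2 • p.1)) (stdVec j)
      = w p.1 * fderiv ℝ a (x - p.2 • p.1) p.1 := by
    intro p
    have hp : p.1 = ∑ j, p.1 j • stdVec j := by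
      ext i
      simp [Finset.sum_apply, Pi.single_apply]
    conv_rhs => rw [hp, map_sum, Finset.mul_sum]
    refine Finset.sum_congr rfl fun j _ => ?_
    rw [← hp]
    simp [mul_assoc]
  have h1 : ∑ j, fderiv ℝ (segmentField r w a j) x (stdVec j)
      = ∫ p, w p.1 * fderiv ℝ a (x - p.2 • p.1) p.1 ∂segmentMeasure n r := by
    simp_rw [← hsum]
    rw [integral_finsetSum _ fun j _ => hint' j]
    refine Finset.sum_congr rfl fun j _ => ?_
    unfold segmentField
    rw [fderiv_averageTranslates (integrable_weight r hw hwc j) measurable_segment ha hac]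
    exact ContinuousLinearMap.integral_apply (hint j) (stdVec j)
  have hi : Integrable (fun p : Rn n × ℝ => w p.1 * fderiv ℝ a (x - p.2 • p.1) p.1)
      (segmentMeasure n r) := by
    simp_rw [← hsum]
    exact integrable_finsetSum _ fun j _ => hint' j
  rw [h1]
  unfold segmentMeasure at hi ⊢
  rw [integral_prod _ hi]
  simp_rw [integral_const_mul, integral_fderiv_segment ha]
  rw [setIntegral_eq_integral_of_forall_compl_eq_zero]
  · simp_rw [mul_sub]
    rw [integral_sub, integral_mul_const]
    · exact (hw.integrable_of_hasCompactSupport hwc).mul_const _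
    · exact (hw.mul (ha.continuous.comp (by fun_prop))).integrable_of_hasCompactSupport
        hwc.mul_right
  · intro y hy
    have : w y = 0 := by
      by_contra h0
      exact hy (hwr h0)
    rw [this, zero_mul]

end Potential

/-! ### Solving the divergence equation locally. -/

section LocalDivergence

variable {n : ℕ} {Ω : Opens (Rn n)}

theorem lineDeriv_testFunction_apply {E : Type*} [NormedAddCommGroup E] [NormedSpace ℝ E]
    (φ : 𝓓(Ω, E)) (v x : Rn n) : (∂_{v} φ : 𝓓(Ω, E)) x = fderiv ℝ φ x v := by
  rw [TestFunction.lineDerivOp_eq_lineDerivCLM ℝ, TestFunction.lineDerivCLM_apply_of_le (by simp)]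
  exact (φ.contDiff.differentiable (by simp)).differentiableAt.lineDeriv_eq_fderiv

theorem testFunction_sum_apply {ι : Type*} (t : Finset ι) (φ : ι → 𝓓(Ω, ℝ)) (x : Rn n) :
    (∑ i ∈ t, φ i) x = ∑ i ∈ t, φ i x := by
  classical
  induction t using Finset.induction_on with
  | empty => rfl
  | insert i t hi ih => rw [Finset.sum_insert hi, Finset.sum_insert hi, ← ih]; rfl

/-- `φ` and its derivative are bounded by `M`. -/
def BoundedCOne (φ : 𝓓(Ω, ℝ)) (M : ℝ) : Prop :=
  (∀ x, ‖φ x‖ ≤ M) ∧ ∀ x, ‖fderiv ℝ φ x‖ ≤ M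

/-- Commutativity of convolution, with the translation by `x₀` moved from one factor to the other;
it makes the convolution terms of the two potentials cancel. -/
theorem integral_mul_add_comm_sub (ψ ρ : Rn n → ℝ) (x₀ x : Rn n) :
    ∫ y, ψ (y + x₀) * ρ (x - y - x₀) = ∫ y, ρ y * ψ (x - y) := by
  rw [← integral_sub_left_eq_self (fun y => ρ y * ψ (x - y)) volume (x - x₀)]
  refine integral_congr_ae (Filter.Eventually.of_forall fun y => ?_)
  simp only
  rw [mul_comm, show x - (x - x₀ - y) = y + x₀ by abel, show x - x₀ - y = x - y - x₀ by abel]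

/-- Near each point of `Ω`, test functions of integral zero are divergences of test fields,
with control of the first order derivatives. -/
theorem exists_local_divergence {x₀ : Rn n} (hx₀ : x₀ ∈ Ω) {ε : ℝ} (hε : 0 < ε) :
    ∃ r > 0, ∃ ρ : 𝓓(Ω, ℝ), tsupport ρ ⊆ Metric.ball x₀ ε ∧ ∫ x, ρ x = 1 ∧
      ∃ C : ℝ, ∀ ψ : 𝓓(Ω, ℝ), tsupport ψ ⊆ Metric.ball x₀ r →
        ∃ Φ : Fin n → 𝓓(Ω, ℝ), ∑ j, ∂_{stdVec j} (Φ j) = ψ - (∫ x, ψ x) • ρ ∧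
          ∀ M, BoundedCOne ψ M → ∀ j, BoundedCOne (Φ j) (C * M) := by
  obtain ⟨R, hR, hRΩ⟩ := Metric.isOpen_iff.1 Ω.isOpen x₀ hx₀
  -- The potentials enlarge supports from radius `r` to `2r`, which must stay below `R`; `r ≤ ε`
  -- keeps `ρ` inside the prescribed ball.
  set r : ℝ := min ε (R / 3) with hr
  have hr0 : 0 < r := by positivity
  have hrε : r ≤ ε := min_le_left _ _
  have hrR : r + r < R := by
    have : r ≤ R / 3 := min_le_right _ _
    linarith
  have hK : Metric.closedBall x₀ (r + r) ⊆ Ω :=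
    (Metric.closedBall_subset_ball hrR).trans hRΩ
  let b : ContDiffBump (0 : Rn n) := ⟨r / 4, r / 2, by positivity, by linarith⟩
  let ρ₀ : Rn n → ℝ := b.normed volume
  have hρ₀ : ContDiff ℝ ∞ ρ₀ := b.contDiff_normed
  have hρ₀c : HasCompactSupport ρ₀ := b.hasCompactSupport_normed
  have hρ₀s : Function.support ρ₀ ⊆ Metric.closedBall 0 r := by
    rw [b.support_normed_eq]
    exact Metric.ball_subset_closedBall.trans (Metric.closedBall_subset_closedBall (by
      change r / 2 ≤ r
      linarith))
  let ρ : Rn n → ℝ := fun x => ρ₀ (x - x₀)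
  have hρ : ContDiff ℝ ∞ ρ := hρ₀.comp (contDiff_id.sub contDiff_const)
  have hρt : tsupport ρ ⊆ Metric.closedBall x₀ (r / 2) := by
    refine closure_minimal (fun x hx => ?_) Metric.isClosed_closedBall
    have h1 : x - x₀ ∈ Function.support ρ₀ := hx
    rw [b.support_normed_eq, mem_ball_zero_iff] at h1
    exact mem_closedBall_iff_norm.2 h1.le
  have hρs : Function.support ρ ⊆ Metric.closedBall x₀ r :=
    (subset_tsupport ρ).trans (hρt.trans (Metric.closedBall_subset_closedBall (by linarith)))
  have hρc : HasCompactSupport ρ :=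
    HasCompactSupport.of_support_subset_isCompact (isCompact_closedBall _ _) hρs
  have hρΩ : tsupport ρ ⊆ Ω :=
    hρt.trans ((Metric.closedBall_subset_closedBall (by linarith)).trans hK)
  obtain ⟨A₁, hA₁⟩ := hρ₀.continuous.bounded_above_of_compact_support hρ₀c
  obtain ⟨A₂, hA₂⟩ := hρ.continuous.bounded_above_of_compact_support hρc
  obtain ⟨A₃, hA₃⟩ := (hρ.continuous_fderiv (by simp)).bounded_above_of_compact_support
    (hρc.fderiv ℝ)
  set m : ℝ := (segmentMeasure n r).real Set.univ
  -- In the constant, `A₁` comes from the potential of `ψ` with weight `ρ₀`; `A₂` and `A₃` bound the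
  -- values and the derivative of the potential of `ρ`, where `ψ` is only a weight.
  refine ⟨r, hr0, ⟨ρ, hρ, hρc, hρΩ⟩, hρt.trans (Metric.closedBall_subset_ball (by linarith)),
    ?_, r * m * (A₁ + max A₂ A₃), fun ψ hψ => ?_⟩
  · change ∫ x, ρ₀ (x - x₀) = 1
    rw [integral_sub_right_eq_self]
    exact b.integral_normed
  let ψ₁ : Rn n → ℝ := fun y => ψ (y + x₀)
  have hψs : Function.support ψ ⊆ Metric.closedBall x₀ r :=
    (subset_tsupport ψ).trans (hψ.trans Metric.ball_subset_closedBall)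
  have hψ₁ : Continuous ψ₁ := ψ.continuous.comp (by fun_prop)
  have hψ₁s : Function.support ψ₁ ⊆ Metric.closedBall 0 r := by
    intro y hy
    have h1 : y + x₀ ∈ Metric.closedBall x₀ r := hψs hy
    rw [mem_closedBall_iff_norm, add_sub_cancel_right] at h1
    simpa using h1
  have hψ₁c : HasCompactSupport ψ₁ :=
    HasCompactSupport.of_support_subset_isCompact (isCompact_closedBall _ _) hψ₁s
  have hψd : ContDiff ℝ ∞ ψ := ψ.contDiff
  -- The two potentials exchange the roles of weight and function. The weight is centred at the
  -- origin in each, so that both fields stay supported near `x₀`.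
  let f : Fin n → Rn n → ℝ := fun j => segmentField r ρ₀ ψ j
  let g : Fin n → Rn n → ℝ := fun j => segmentField r ψ₁ ρ j
  have hf : ∀ j, ContDiff ℝ ∞ (f j) :=
    contDiff_segmentField r hρ₀.continuous hρ₀c hψd ψ.hasCompactSupport
  have hg : ∀ j, ContDiff ℝ ∞ (g j) := contDiff_segmentField r hψ₁ hψ₁c hρ hρc
  have hfg : ∀ j, Function.support (f j - g j) ⊆ Metric.closedBall x₀ (r + r) := fun j =>
    (Function.support_sub _ _).trans (Set.union_subset (support_segmentField_subset hψs j)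
      (support_segmentField_subset hρs j))
  have hfd : ∀ j x, DifferentiableAt ℝ (f j) x := fun j x =>
    ((hf j).differentiable (by simp)).differentiableAt
  have hgd : ∀ j x, DifferentiableAt ℝ (g j) x := fun j x =>
    ((hg j).differentiable (by simp)).differentiableAt
  let Φ : Fin n → 𝓓(Ω, ℝ) := fun j => ⟨f j - g j, (hf j).sub (hg j),
    HasCompactSupport.of_support_subset_isCompact (isCompact_closedBall _ _) (hfg j),
    (closure_minimal (hfg j) Metric.isClosed_closedBall).trans hK⟩
  have hΦ : ∀ j x, fderiv ℝ (Φ j) x = fderiv ℝ (f j) x - fderiv ℝ (g j) x := fun j x =>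
    fderiv_sub (hfd j x) (hgd j x)
  refine ⟨Φ, ?_, fun M hM j => ⟨fun x => ?_, fun x => ?_⟩⟩
  · ext x
    rw [testFunction_sum_apply]
    simp_rw [lineDeriv_testFunction_apply, hΦ, sub_apply]
    rw [Finset.sum_sub_distrib,
      sum_fderiv_segmentField hρ₀.continuous hρ₀c hρ₀s (hψd.of_le (by simp)) ψ.hasCompactSupport,
      sum_fderiv_segmentField hψ₁ hψ₁c hψ₁s (hρ.of_le (by simp)) hρc]
    have h1 : ∫ y, ρ₀ y = 1 := b.integral_normed
    have h2 : ∫ y, ψ₁ y = ∫ y, ψ y := integral_add_right_eq_self (fun y => ψ y) x₀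
    have h3 : ∫ y, ψ₁ y * ρ (x - y) = ∫ y, ρ₀ y * ψ (x - y) :=
      integral_mul_add_comm_sub ψ ρ₀ x₀ x
    rw [h1, h2, h3]
    change _ = ψ x - (∫ y, ψ y) * ρ x
    ring
  · have hM0 : 0 ≤ M := (norm_nonneg _).trans (hM.1 x)
    have e1 := norm_segmentField_le (r := r) hA₁ hM.1 j x
    have e2 := norm_segmentField_le (r := r) (w := ψ₁) (fun y => hM.1 (y + x₀)) hA₂ j x
    calc ‖f j x - g j x‖ ≤ A₁ * r * M * m + M * r * A₂ * m :=
          (norm_sub_le _ _).trans (add_le_add e1 e2)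
      _ ≤ A₁ * r * M * m + M * r * max A₂ A₃ * m := by gcongr; exact le_max_left _ _
      _ = _ := by ring
  · have hM0 : 0 ≤ M := (norm_nonneg _).trans (hM.1 x)
    have e1 := norm_fderiv_segmentField_le (r := r) hρ₀.continuous hρ₀c (hψd.of_le (by simp))
      ψ.hasCompactSupport hA₁ hM.2 j x
    have e2 := norm_fderiv_segmentField_le (r := r) hψ₁ hψ₁c (hρ.of_le (by simp)) hρc
      (fun y => hM.1 (y + x₀)) hA₃ j x
    rw [hΦ]
    calc ‖fderiv ℝ (f j) x - fderiv ℝ (g j) x‖ ≤ A₁ * r * M * m + M * r * A₃ * m :=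
          (norm_sub_le _ _).trans (add_le_add e1 e2)
      _ ≤ A₁ * r * M * m + M * r * max A₂ A₃ * m := by gcongr; exact le_max_right _ _
      _ = _ := by ring

end LocalDivergence

/-! ### Localising test functions by finite partitions of unity. -/

section PartitionOfUnity

variable {n : ℕ} {Ω : Opens (Rn n)}

theorem exists_finite_partition {K : Set (Rn n)} (hK : IsCompact K) (r : Rn n → ℝ)
    (hr : ∀ x ∈ K, 0 < r x) :
    ∃ (t : Finset (Rn n)) (χ : Rn n → Rn n → ℝ), (∀ i ∈ t, i ∈ K) ∧
      (∀ i, ContDiff ℝ ∞ (χ i)) ∧ (∀ i ∈ t, tsupport (χ i) ⊆ Metric.ball i (r i)) ∧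
      ∀ x ∈ K, ∑ i ∈ t, χ i x = 1 := by
  obtain ⟨t, ht, hKt⟩ := hK.elim_nhds_subcover (fun x => Metric.ball x (r x))
    fun x hx => Metric.ball_mem_nhds x (hr x hx)
  obtain ⟨f, hf⟩ := SmoothPartitionOfUnity.exists_isSubordinate (modelWithCornersSelf ℝ (Rn n))
    hK.isClosed (fun i : t => Metric.ball (i : Rn n) (r i)) (fun _ => Metric.isOpen_ball)
    (by simpa [Set.iUnion_subtype] using hKt)
  classical
  refine ⟨t, fun i => if h : i ∈ t then f ⟨i, h⟩ else 0, ht, fun i => ?_, fun i hi => ?_,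
    fun x hx => ?_⟩
  · by_cases h : i ∈ t
    · simpa only [h, dif_pos] using (f ⟨i, h⟩).contMDiff.contDiff
    · simp only [h, dif_neg, not_false_iff]
      exact contDiff_const
  · simpa only [hi, dif_pos] using hf ⟨i, hi⟩
  · rw [← f.sum_eq_one hx, finsum_eq_sum_of_fintype, ← Finset.sum_coe_sort]
    simp

/-- The product of a test function with a smooth function. -/
def mulTest (χ : Rn n → ℝ) (hχ : ContDiff ℝ ∞ χ) (ψ : 𝓓(Ω, ℝ)) : 𝓓(Ω, ℝ) :=
  ⟨fun x => χ x * ψ x, hχ.mul ψ.contDiff, ψ.hasCompactSupport.mul_left,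
    (tsupport_mul_subset_right).trans ψ.tsupport_subset⟩

theorem tsupport_mulTest_subset (χ : Rn n → ℝ) (hχ : ContDiff ℝ ∞ χ) (ψ : 𝓓(Ω, ℝ)) :
    tsupport (mulTest χ hχ ψ) ⊆ tsupport χ :=
  tsupport_mul_subset_left

theorem sum_mulTest {t : Finset (Rn n)} {χ : Rn n → Rn n → ℝ} (hχ : ∀ i, ContDiff ℝ ∞ (χ i))
    {K : Set (Rn n)} (h1 : ∀ x ∈ K, ∑ i ∈ t, χ i x = 1) (ψ : 𝓓(Ω, ℝ))
    (hψ : Function.support ψ ⊆ K) : ∑ i ∈ t, mulTest (χ i) (hχ i) ψ = ψ := by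
  ext x
  rw [testFunction_sum_apply]
  change ∑ i ∈ t, χ i x * ψ x = ψ x
  rw [← Finset.sum_mul]
  by_cases hx : ψ x = 0
  · rw [hx, mul_zero]
  · rw [h1 x (hψ hx), one_mul]

end PartitionOfUnity

/-! ### Continuity from local bounds; factoring through the divergence. -/

section Continuity

variable {n : ℕ} {Ω : Opens (Rn n)}

theorem exists_bound_mulTest {χ : Rn n → ℝ} (hχ : ContDiff ℝ ∞ χ) (hχc : HasCompactSupport χ) :
    ∃ B : ℝ, ∀ (ψ : 𝓓(Ω, ℝ)) (M : ℝ), BoundedCOne ψ M →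
      BoundedCOne (mulTest χ hχ ψ) (B * M) := by
  obtain ⟨B₁, hB₁⟩ := hχ.continuous.bounded_above_of_compact_support hχc
  obtain ⟨B₂, hB₂⟩ := (hχ.continuous_fderiv (by simp)).bounded_above_of_compact_support
    (hχc.fderiv ℝ)
  have hB₁0 : 0 ≤ B₁ := (norm_nonneg _).trans (hB₁ 0)
  have hB₂0 : 0 ≤ B₂ := (norm_nonneg _).trans (hB₂ 0)
  refine ⟨B₁ + B₂, fun ψ M hM => ⟨fun x => ?_, fun x => ?_⟩⟩ <;>
    have hM0 : 0 ≤ M := (norm_nonneg _).trans (hM.1 x)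
  · calc ‖χ x * ψ x‖ = ‖χ x‖ * ‖ψ x‖ := norm_mul _ _
      _ ≤ B₁ * M := mul_le_mul (hB₁ x) (hM.1 x) (norm_nonneg _) hB₁0
      _ ≤ (B₁ + B₂) * M := by gcongr; linarith
  · have h1 : fderiv ℝ (mulTest χ hχ ψ) x = χ x • fderiv ℝ ψ x + ψ x • fderiv ℝ χ x :=
      fderiv_mul (hχ.differentiable (by simp)).differentiableAt
        (ψ.contDiff.differentiable (by simp)).differentiableAt
    rw [h1]
    calc _ ≤ ‖χ x‖ * ‖fderiv ℝ ψ x‖ + ‖ψ x‖ * ‖fderiv ℝ χ x‖ := by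
          rw [← norm_smul, ← norm_smul]
          exact norm_add_le _ _
      _ ≤ B₁ * M + M * B₂ := add_le_add
          (mul_le_mul (hB₁ x) (hM.2 x) (norm_nonneg _) hB₁0)
          (mul_le_mul (hM.1 x) (hB₂ x) (norm_nonneg _) hM0)
      _ = (B₁ + B₂) * M := by ring

/-- A linear functional on test functions that is locally of order at most one is continuous. -/
theorem continuous_of_locally_bounded {E : Type*} [NormedAddCommGroup E] [NormedSpace ℝ E]
    (L : 𝓓(Ω, ℝ) →ₗ[ℝ] E)
    (hL : ∀ x ∈ Ω, ∃ r > 0, ∃ C : ℝ, ∀ ψ : 𝓓(Ω, ℝ), tsupport ψ ⊆ Metric.ball x r →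
      ∀ M, BoundedCOne ψ M → ‖L ψ‖ ≤ C * M) : Continuous L := by
  rw [TestFunction.continuous_iff_continuous_comp]
  intro K hK
  choose! r hr C hC using hL
  obtain ⟨t, χ, htK, hχ, hχr, h1⟩ := exists_finite_partition K.isCompact r
    fun x hx => hr x (hK hx)
  have hχc : ∀ i ∈ t, HasCompactSupport (χ i) := fun i hi =>
    (isCompact_closedBall i (r i)).of_isClosed_subset (isClosed_tsupport _)
      ((hχr i hi).trans Metric.ball_subset_closedBall)
  choose! B hB using fun i (hi : i ∈ t) => exists_bound_mulTest (Ω := Ω) (hχ i) (hχc i hi)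
  -- The seminorms of orders 0 and 1 suffice. The absolute values are needed because the local
  -- constants may be negative.
  refine (ContDiffMapSupportedIn.mkCLMtoNormedSpace ℝ (L ∘ TestFunction.ofSupportedIn hK)
    (fun f g => L.map_add (TestFunction.ofSupportedIn hK f)
      (TestFunction.ofSupportedIn hK g)) (fun c f => L.map_smul c (TestFunction.ofSupportedIn hK f))
    ⟨{0, 1}, ∑ i ∈ t, |C i * B i|, by positivity, fun f => ?_⟩).continuous
  set ψ : 𝓓(Ω, ℝ) := TestFunction.ofSupportedIn hK f with hψ
  set M := (({0, 1} : Finset ℕ).sup fun i =>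
    ContDiffMapSupportedIn.seminorm ℝ (Rn n) ℝ ⊤ K i) f with hMdef
  have hM0 : 0 ≤ M := apply_nonneg _ _
  have hM : BoundedCOne ψ M := by
    refine ⟨fun x => ?_, fun x => ?_⟩
    · refine (ContDiffMapSupportedIn.norm_apply_le_seminorm ℝ (f := f)).trans ?_
      exact (Finset.le_sup (f := fun i => ContDiffMapSupportedIn.seminorm ℝ (Rn n) ℝ ⊤ K i)
        (by simp : 0 ∈ ({0, 1} : Finset ℕ))) f
    · rw [← norm_iteratedFDeriv_one]
      refine (ContDiffMapSupportedIn.norm_iteratedFDeriv_apply_le_seminorm_top ℝ (f := f)).trans ?_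
      exact (Finset.le_sup (f := fun i => ContDiffMapSupportedIn.seminorm ℝ (Rn n) ℝ ⊤ K i)
        (by simp : 1 ∈ ({0, 1} : Finset ℕ))) f
  change ‖L ψ‖ ≤ _
  rw [← sum_mulTest hχ h1 ψ f.support_subset, map_sum, Finset.sum_mul]
  refine (norm_sum_le _ _).trans (Finset.sum_le_sum fun i hi => ?_)
  calc _ ≤ C i * (B i * M) := hC i (hK (htK i hi)) _
        ((tsupport_mulTest_subset _ _ _).trans (hχr i hi)) _ (hB i hi ψ M hM)
    _ = C i * B i * M := by ring
    _ ≤ |C i * B i| * M := by gcongr; exact le_abs_self _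

/-- The first isomorphism theorem defines `L` on the range of `d`; a purely algebraic extension
reaches all of `B`, without any continuity. -/
theorem exists_linear_factor {A B E : Type*} [AddCommGroup A] [Module ℝ A] [AddCommGroup B]
    [Module ℝ B] [AddCommGroup E] [Module ℝ E] (d : A →ₗ[ℝ] B) (G : A →ₗ[ℝ] E)
    (h : ∀ a, d a = 0 → G a = 0) : ∃ L : B →ₗ[ℝ] E, ∀ a, L (d a) = G a := by
  obtain ⟨L, hL⟩ := LinearMap.exists_extend
    (((LinearMap.ker d).liftQ G h).comp d.quotKerEquivRange.symm.toLinearMap)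
  refine ⟨L, fun a => ?_⟩
  have h1 := LinearMap.congr_fun hL ⟨d a, LinearMap.mem_range_self d a⟩
  have h2 : d.quotKerEquivRange.symm ⟨d a, LinearMap.mem_range_self d a⟩
      = (LinearMap.ker d).mkQ a := d.quotKerEquivRange_symm_apply_image a _
  exact h1.trans ((congrArg ((LinearMap.ker d).liftQ G h) h2).trans
    (Submodule.liftQ_apply (LinearMap.ker d) G a))

/-- The divergence of a field of real test functions. -/
def divTest (Ω : Opens (Rn n)) : (Fin n → 𝓓(Ω, ℝ)) →ₗ[ℝ] 𝓓(Ω, ℝ) where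
  toFun φ := ∑ j, ∂_{stdVec j} (φ j)
  map_add' φ ψ := by
    simp [LineDeriv.lineDerivOp_add, Finset.sum_add_distrib]
  map_smul' c φ := by
    simp [LineDeriv.lineDerivOp_smul, Finset.smul_sum]

theorem divTest_single (j : Fin n) (φ : 𝓓(Ω, ℝ)) :
    divTest Ω (Pi.single j φ) = ∂_{stdVec j} φ := by
  change ∑ i, ∂_{stdVec i} ((Pi.single j φ : Fin n → 𝓓(Ω, ℝ)) i) = _
  rw [Finset.sum_eq_single j]
  · rw [Pi.single_eq_same]
  · intro i _ hi
    rw [Pi.single_eq_of_ne hi, LineDeriv.lineDerivOp_zero]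
  · simp

end Continuity

/-! ### Functionals in H⁻¹ on real test functions, and the distributional de Rham theorem. -/

section DualTest

variable {n : ℕ} {Ω : Opens (Rn n)} {𝕜 : Type*} [RCLike 𝕜]

theorem realTest_add (φ ψ : 𝓓(Ω, ℝ)) : realTest 𝕜 (φ + ψ) = realTest 𝕜 φ + realTest 𝕜 ψ :=
  map_add (TestFunction.postcompCLM (RCLike.ofRealCLM : ℝ →L[ℝ] 𝕜)) φ ψ

theorem realTest_smul (c : ℝ) (φ : 𝓓(Ω, ℝ)) :
    realTest 𝕜 (c • φ) = (c : 𝕜) • realTest 𝕜 φ := by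
  ext x
  change ((c * φ x : ℝ) : 𝕜) = (c : 𝕜) * (φ x : 𝕜)
  push_cast
  rfl

theorem lineDeriv_postcomp {E E' : Type*} [NormedAddCommGroup E] [NormedSpace ℝ E]
    [NormedAddCommGroup E'] [NormedSpace ℝ E'] (A : E →L[ℝ] E') (v : Rn n) (φ : 𝓓(Ω, E)) :
    ∂_{v} (TestFunction.postcompCLM A φ : 𝓓(Ω, E')) = TestFunction.postcompCLM A (∂_{v} φ) := by
  ext x
  rw [lineDeriv_testFunction_apply]
  change _ = A ((∂_{v} φ : 𝓓(Ω, E)) x)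
  rw [lineDeriv_testFunction_apply]
  have h := A.hasFDerivAt.comp x (φ.contDiff.differentiable (by simp) x).hasFDerivAt
  exact congrArg (fun B : Rn n →L[ℝ] E' => B v) h.fderiv

theorem lineDeriv_realTest (v : Rn n) (φ : 𝓓(Ω, ℝ)) :
    ∂_{v} (realTest 𝕜 φ) = realTest 𝕜 (∂_{v} φ) :=
  lineDeriv_postcomp _ v φ

/-- A functional in `H⁻¹(Ω)` evaluated on real test functions. -/
def evalRealTest (g : HNegOne Ω 𝕜) : 𝓓(Ω, ℝ) →ₗ[ℝ] 𝕜 where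
  toFun φ := g (testToHOneZero Ω 𝕜 (realTest 𝕜 φ))
  map_add' φ ψ := by rw [realTest_add, map_add, map_add]
  map_smul' c φ := by
    rw [realTest_smul, map_smul, map_smulₛₗ, RCLike.conj_ofReal, smul_eq_mul, RingHom.id_apply,
      RCLike.real_smul_eq_coe_mul]

theorem norm_testToLTwo_le (hbdd : Bornology.IsBounded (Ω : Set (Rn n))) :
    ∃ C : ℝ, 0 ≤ C ∧ ∀ (φ : 𝓓(Ω, 𝕜)) (M : ℝ), (∀ x, ‖φ x‖ ≤ M) →
      ‖testToLTwo Ω 𝕜 φ‖ ≤ C * M := by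
  have : IsFiniteMeasure ((volume : Measure (Rn n)).restrict Ω) :=
    isFiniteMeasure_restrict.2 hbdd.measure_lt_top.ne
  refine ⟨_, by positivity, fun φ M hM => Lp.norm_le_of_ae_bound
    ((norm_nonneg _).trans (hM 0)) ?_⟩
  filter_upwards [(testFunction_memLp φ).coeFn_toLp] with x hx
  exact (congrArg norm hx).trans_le (hM x)

theorem norm_testToHOneZero_le (φ : 𝓓(Ω, 𝕜)) :
    ‖testToHOneZero Ω 𝕜 φ‖
      ≤ ‖testToLTwo Ω 𝕜 φ‖ + ∑ j : Fin n, ‖testToLTwo Ω 𝕜 (∂_{stdVec j} φ)‖ := by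
  have hpi : ∀ v : PiLp 2 (fun _ : Fin n => LTwo Ω 𝕜), ‖v‖ ≤ ∑ j, ‖v j‖ := by
    intro v
    rw [PiLp.norm_eq_of_L2]
    refine Real.sqrt_le_iff.2 ⟨by positivity, ?_⟩
    exact Finset.sum_sq_le_sq_sum_of_nonneg fun _ _ => norm_nonneg _
  have hprod : ∀ p : LTwoProd Ω 𝕜, ‖p‖ ≤ ‖p.fst‖ + ‖p.snd‖ := by
    intro p
    rw [WithLp.prod_norm_eq_of_L2]
    refine Real.sqrt_le_iff.2 ⟨by positivity, ?_⟩
    nlinarith [norm_nonneg p.fst, norm_nonneg p.snd]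
  exact (hprod (testToHOne Ω 𝕜 φ : LTwoProd Ω 𝕜)).trans (add_le_add_right (hpi _) _)

theorem hNegOne_norm_apply_le (g : HNegOne Ω 𝕜) :
    ∃ C : ℝ, 0 ≤ C ∧ ∀ u : HOneZero Ω 𝕜, ‖g u‖ ≤ C * ‖u‖ := by
  have key : ∀ {U : Type _} [NormedAddCommGroup U] [NormedSpace 𝕜 U] (g : U →L⋆[𝕜] 𝕜),
      ∃ C : ℝ, 0 ≤ C ∧ ∀ u, ‖g u‖ ≤ C * ‖u‖ := fun g => ⟨‖g‖, norm_nonneg _, g.le_opNorm⟩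
  exact @key (HOneZero Ω 𝕜) inferInstance (HOneZero Ω 𝕜).normedSpace g

/-- On a bounded set the C¹ bound controls the H¹ norm, one term coming from `φ` and `n` from its
partial derivatives. Hence elements of H⁻¹ have order at most one. -/
theorem exists_bound_evalRealTest (hbdd : Bornology.IsBounded (Ω : Set (Rn n)))
    (g : HNegOne Ω 𝕜) :
    ∃ C : ℝ, ∀ (φ : 𝓓(Ω, ℝ)) (M : ℝ), BoundedCOne φ M → ‖evalRealTest g φ‖ ≤ C * M := by
  obtain ⟨C, hC0, hC⟩ := norm_testToLTwo_le (𝕜 := 𝕜) hbdd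
  obtain ⟨D, hD0, hD⟩ := hNegOne_norm_apply_le g
  refine ⟨D * (C + n * C), fun φ M hM => ?_⟩
  have h0 : ‖testToLTwo Ω 𝕜 (realTest 𝕜 φ)‖ ≤ C * M :=
    hC _ _ fun x => (RCLike.norm_ofReal (φ x)).trans_le (hM.1 x)
  have h1 : ∀ j : Fin n, ‖testToLTwo Ω 𝕜 (∂_{stdVec j} (realTest 𝕜 φ))‖ ≤ C * M := by
    refine fun j => hC _ _ fun x => ?_
    rw [lineDeriv_realTest]
    refine (RCLike.norm_ofReal ((∂_{stdVec j} φ : 𝓓(Ω, ℝ)) x)).trans_le ?_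
    rw [lineDeriv_testFunction_apply, ← Real.norm_eq_abs]
    refine ((fderiv ℝ φ x).le_opNorm _).trans ?_
    simpa using hM.2 x
  calc ‖evalRealTest g φ‖ ≤ D * ‖testToHOneZero Ω 𝕜 (realTest 𝕜 φ)‖ := hD _
    _ ≤ D * (C * M + ∑ _j : Fin n, C * M) := by
        gcongr
        exact (norm_testToHOneZero_le _).trans
          (add_le_add h0 (Finset.sum_le_sum fun j _ => h1 j))
    _ = _ := by simp; ring

/-- A field in `H⁻¹(Ω)ⁿ` vanishing on divergence free test fields is the gradient of a
distribution. -/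
theorem exists_distribution_of_mem_polar (hbdd : Bornology.IsBounded (Ω : Set (Rn n)))
    {g : Fin n → HNegOne Ω 𝕜} (hg : g ∈ polar (divFreeTest Ω 𝕜)) :
    ∃ F : 𝓓'(Ω, 𝕜), ∀ j φ, (∂_{stdVec j} F : 𝓓'(Ω, 𝕜)) φ = evalRealTest (g j) φ := by
  let G : (Fin n → 𝓓(Ω, ℝ)) →ₗ[ℝ] 𝕜 :=
    ∑ j, (evalRealTest (g j)).comp (LinearMap.proj j)
  have hG : ∀ φ, G φ = ∑ j, evalRealTest (g j) (φ j) := fun φ => by simp [G]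
  -- The sign is that of the distributional derivative, `(∂ⱼF)(φ) = -F(∂ⱼφ)`.
  obtain ⟨L, hL⟩ := exists_linear_factor (divTest Ω) (-G) fun φ hφ => by
    rw [LinearMap.neg_apply, hG, neg_eq_zero]
    refine hg _ ⟨fun j => realTest 𝕜 (φ j), ?_, fun j => rfl⟩
    simp_rw [lineDeriv_realTest]
    have h1 : ∑ j, realTest 𝕜 (∂_{stdVec j} (φ j))
        = realTest 𝕜 (∑ j, ∂_{stdVec j} (φ j)) :=
      (map_sum (TestFunction.postcompCLM (RCLike.ofRealCLM : ℝ →L[ℝ] 𝕜)) _ _).symm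
    have h2 : ∑ j, ∂_{stdVec j} (φ j) = 0 := hφ
    rw [h1, h2]
    exact map_zero (TestFunction.postcompCLM (RCLike.ofRealCLM : ℝ →L[ℝ] 𝕜))
  choose D hD using fun j => exists_bound_evalRealTest hbdd (g j)
  have hcont : Continuous L := by
    -- Locally `L ψ` is `-G Φ` plus `∫ψ` times the fixed value `L ρ`. Both are controlled by the C¹
    -- bound, however `L` was extended; the radius 1 for `ρ` is arbitrary.
    refine continuous_of_locally_bounded L fun x hx => ?_
    obtain ⟨r, hr, ρ, -, -, C, hC⟩ := exists_local_divergence hx one_pos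
    refine ⟨r, hr, ∑ j, D j * C
      + (volume : Measure (Rn n)).real (Metric.ball x r) * ‖L ρ‖, fun ψ hψ M hM => ?_⟩
    obtain ⟨Φ, hΦ, hΦM⟩ := hC ψ hψ
    have hM0 : 0 ≤ M := (norm_nonneg _).trans (hM.1 0)
    have h1 : L ψ = - ∑ j, evalRealTest (g j) (Φ j) + (∫ x, ψ x) • L ρ := by
      rw [← hG, ← LinearMap.neg_apply, ← hL, ← map_smul, ← map_add]
      congr 1
      change ψ = ∑ j, ∂_{stdVec j} (Φ j) + _
      rw [hΦ, sub_add_cancel]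
    have h2 : ‖∫ x, ψ x‖ ≤ M * (volume : Measure (Rn n)).real (Metric.ball x r) := by
      rw [← setIntegral_eq_integral_of_forall_compl_eq_zero (s := Metric.ball x r)
        fun y hy => image_eq_zero_of_notMem_tsupport fun h => hy (hψ h)]
      exact norm_setIntegral_le_of_norm_le_const measure_ball_lt_top fun y _ => hM.1 y
    rw [h1]
    calc _ ≤ ∑ j, ‖evalRealTest (g j) (Φ j)‖ + ‖∫ x, ψ x‖ * ‖L ρ‖ := by
          refine (norm_add_le _ _).trans (add_le_add ?_ (norm_smul_le _ _))
          rw [norm_neg]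
          exact norm_sum_le _ _
      _ ≤ ∑ j, D j * (C * M)
          + M * (volume : Measure (Rn n)).real (Metric.ball x r) * ‖L ρ‖ := by
          gcongr with j
          exact hD j _ _ (hΦM M hM j)
      _ = _ := by
          rw [add_mul, Finset.sum_mul]
          congr 1
          · exact Finset.sum_congr rfl fun j _ => by ring
          · ring
  let F : 𝓓'(Ω, 𝕜) := (⟨L, hcont⟩ : 𝓓(Ω, ℝ) →L[ℝ] 𝕜)
  refine ⟨F, fun j φ => ?_⟩
  rw [Distribution.lineDerivOp_apply_apply, map_neg]
  change - L (∂_{stdVec j} φ) = _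
  rw [← divTest_single, hL, LinearMap.neg_apply, neg_neg, hG, Finset.sum_eq_single j]
  · rw [Pi.single_eq_same]
  · intro i _ hi
    rw [Pi.single_eq_of_ne hi, map_zero]
  · simp

end DualTest

/-! ### Functionals vanishing on divergences are constants. -/

section Constant

variable {n : ℕ} {Ω : Opens (Rn n)}

/-- A linear functional on test functions that vanishes on divergences is a multiple of the
integral, if `Ω` is connected. -/
theorem exists_eq_integral_smul {E : Type*} [NormedAddCommGroup E] [NormedSpace ℝ E]
    (hconn : IsConnected (Ω : Set (Rn n))) (T : 𝓓(Ω, ℝ) →ₗ[ℝ] E)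
    (hT : ∀ Φ, T (divTest Ω Φ) = 0) : ∃ c : E, ∀ ψ : 𝓓(Ω, ℝ), T ψ = (∫ x, ψ x) • c := by
  have hloc : ∀ x ∈ Ω, ∀ ε > 0, ∃ r > 0, ∃ ρ : 𝓓(Ω, ℝ), tsupport ρ ⊆ Metric.ball x ε ∧
      ∫ y, ρ y = 1 ∧ ∀ ψ : 𝓓(Ω, ℝ), tsupport ψ ⊆ Metric.ball x r →
        T ψ = (∫ y, ψ y) • T ρ := by
    intro x hx ε hε
    obtain ⟨r, hr, ρ, hρs, hρ, C, hC⟩ := exists_local_divergence hx hε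
    refine ⟨r, hr, ρ, hρs, hρ, fun ψ hψ => ?_⟩
    obtain ⟨Φ, hΦ, -⟩ := hC ψ hψ
    have h := hT Φ
    rw [show divTest Ω Φ = _ from hΦ, map_sub, map_smul, sub_eq_zero] at h
    exact h
  obtain ⟨x₀, hx₀⟩ := hconn.nonempty
  obtain ⟨r₀, hr₀, ρ₀, -, -, h₀⟩ := hloc x₀ hx₀ 1 one_pos
  -- Points near which the constant is the one found at `x₀`. This set is open and relatively closed
  -- in `Ω`, so by connectedness it contains `Ω`.
  set S : Set (Rn n) := {x | ∃ r > 0, ∀ ψ : 𝓓(Ω, ℝ), tsupport ψ ⊆ Metric.ball x r →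
    T ψ = (∫ y, ψ y) • T ρ₀} with hS
  have hSo : IsOpen S := by
    refine Metric.isOpen_iff.2 fun x ⟨r, hr, h⟩ => ⟨r, hr, fun y hy => ?_⟩
    refine ⟨r - dist y x, sub_pos.2 hy, fun ψ hψ => h ψ (hψ.trans ?_)⟩
    exact Metric.ball_subset_ball' (by linarith)
  have hΩS : (Ω : Set (Rn n)) ⊆ S := by
    refine hconn.isPreconnected.subset_of_closure_inter_subset hSo
      ⟨x₀, hx₀, r₀, hr₀, h₀⟩ fun x ⟨hxS, hx⟩ => ?_
    obtain ⟨r, hr, ρ, -, -, h⟩ := hloc x hx 1 one_pos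
    obtain ⟨y, ⟨hyr, hyΩ⟩, s, hs, hyS⟩ := mem_closure_iff.1 hxS (Metric.ball x r ∩ Ω)
      (Metric.isOpen_ball.inter Ω.isOpen) ⟨Metric.mem_ball_self hr, hx⟩
    -- A test function of integral 1 supported in both neighbourhoods forces the two local constants
    -- to agree.
    obtain ⟨-, -, σ, hσs, hσ, -⟩ := hloc y hyΩ (min s (r - dist y x))
      (lt_min hs (sub_pos.2 hyr))
    have h1 := hyS σ (hσs.trans (Metric.ball_subset_ball (min_le_left _ _)))
    have h2 := h σ (hσs.trans (Metric.ball_subset_ball' (by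
      linarith [min_le_right s (r - dist y x)])))
    rw [hσ, one_smul] at h1 h2
    exact ⟨r, hr, fun ψ hψ => by rw [h ψ hψ, ← h2, h1]⟩
  refine ⟨T ρ₀, fun ψ => ?_⟩
  choose! r hr h using fun x (hx : x ∈ Ω) => hΩS hx
  obtain ⟨t, χ, htK, hχ, hχr, h1⟩ := exists_finite_partition ψ.hasCompactSupport r
    fun x hx => hr x (ψ.tsupport_subset hx)
  have hsum := sum_mulTest hχ h1 ψ (subset_tsupport ψ)
  have hint : ∫ x, ψ x = ∑ i ∈ t, ∫ x, mulTest (χ i) (hχ i) ψ x := by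
    rw [← integral_finsetSum _ fun i _ => TestFunction.integrable
      ((locallyIntegrable_const _).locallyIntegrableOn _) _]
    conv_lhs => rw [← hsum]
    simp_rw [testFunction_sum_apply]
  conv_lhs => rw [← hsum]
  rw [map_sum, hint, Finset.sum_smul]
  exact Finset.sum_congr rfl fun i hi => h i (ψ.tsupport_subset (htK i hi)) _
    ((tsupport_mulTest_subset _ _ _).trans (hχr i hi))

end Constant

/-! ### Passage between real and `𝕜`-valued test functions, and the two implications. -/

section Main

variable {n : ℕ} {Ω : Opens (Rn n)} {𝕜 : Type*} [RCLike 𝕜]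

/-- The real part of a test function. -/
def reTest (φ : 𝓓(Ω, 𝕜)) : 𝓓(Ω, ℝ) :=
  TestFunction.postcompCLM (RCLike.reCLM : 𝕜 →L[ℝ] ℝ) φ

/-- The imaginary part of a test function. -/
def imTest (φ : 𝓓(Ω, 𝕜)) : 𝓓(Ω, ℝ) :=
  TestFunction.postcompCLM (RCLike.imCLM : 𝕜 →L[ℝ] ℝ) φ

/-- Splitting into real and imaginary parts; conjugate linearity produces the conjugate of `I`. Real
test functions thus determine a functional in H⁻¹. -/
theorem hNegOne_apply_test (g : HNegOne Ω 𝕜) (φ : 𝓓(Ω, 𝕜)) :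
    g (testToHOneZero Ω 𝕜 φ) = evalRealTest g (reTest φ)
      + (starRingEnd 𝕜) RCLike.I * evalRealTest g (imTest φ) := by
  have h : φ = realTest 𝕜 (reTest φ) + (RCLike.I : 𝕜) • realTest 𝕜 (imTest φ) := by
    ext x
    change φ x = ((RCLike.re (φ x) : ℝ) : 𝕜) + RCLike.I * ((RCLike.im (φ x) : ℝ) : 𝕜)
    rw [mul_comm, RCLike.re_add_im]
  conv_lhs => rw [h, map_add, map_add, map_smul, map_smulₛₗ, smul_eq_mul]
  rfl

theorem denseRange_testToHOneZero : DenseRange (testToHOneZero Ω 𝕜) := by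
  refine Subtype.dense_iff.2 fun u hu => ?_
  rw [← Set.range_comp]
  exact hu

theorem hNegOne_ext {g h : HNegOne Ω 𝕜} (hgh : ∀ φ, evalRealTest g φ = evalRealTest h φ) :
    g = h := by
  refine DFunLike.ext' (denseRange_testToHOneZero.equalizer g.continuous h.continuous
    (funext fun φ => ?_))
  simp only [Function.comp_apply, hNegOne_apply_test, hgh]

theorem inner_realTest (φ : 𝓓(Ω, ℝ)) (f : LTwo Ω 𝕜) :
    inner 𝕜 (testToLTwo Ω 𝕜 (realTest 𝕜 φ)) f = ∫ x in (Ω : Set (Rn n)), φ x • f x := by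
  rw [L2.inner_def]
  refine integral_congr_ae ?_
  filter_upwards [(testFunction_memLp (realTest 𝕜 φ)).coeFn_toLp] with x hx
  change inner 𝕜 (((testFunction_memLp (realTest 𝕜 φ)).toLp _ : LTwo Ω 𝕜) x) (f x) = _
  rw [hx, RCLike.inner_apply, RCLike.real_smul_eq_coe_mul, mul_comm]
  congr 1
  exact RCLike.conj_ofReal _

theorem evalRealTest_grad (f : LTwo Ω 𝕜) (j : Fin n) (φ : 𝓓(Ω, ℝ)) :
    evalRealTest (grad f j) φ = - ∫ x in (Ω : Set (Rn n)), (∂_{stdVec j} φ : 𝓓(Ω, ℝ)) x • f x := by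
  rw [← inner_realTest, ← lineDeriv_realTest]
  rfl

theorem propHc_of_lionsProperty (hbdd : Bornology.IsBounded (Ω : Set (Rn n)))
    (h : LionsProperty Ω 𝕜) : PropHc Ω 𝕜 := by
  intro g hg
  obtain ⟨F, hF⟩ := exists_distribution_of_mem_polar hbdd hg
  obtain ⟨f, hf⟩ := h F fun j => ⟨g j, hF j⟩
  refine ⟨f, funext fun j => hNegOne_ext fun φ => ?_⟩
  rw [← hF, evalRealTest_grad, Distribution.lineDerivOp_apply_apply, map_neg, hf]

/-- The pairing with a test field is `-F` of its divergence. As `F` sees only real test functions,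
this is applied to the real and imaginary parts, each divergence free. -/
theorem mem_polar_of_distribution {F : 𝓓'(Ω, 𝕜)} {g : Fin n → HNegOne Ω 𝕜}
    (hg : ∀ j φ, (∂_{stdVec j} F : 𝓓'(Ω, 𝕜)) φ = evalRealTest (g j) φ) :
    g ∈ polar (divFreeTest Ω 𝕜) := by
  have hdiv : ∀ A : 𝕜 →L[ℝ] ℝ, ∀ φ : Fin n → 𝓓(Ω, 𝕜), ∑ j, ∂_{stdVec j} (φ j) = 0 →
      ∑ j, evalRealTest (g j) (TestFunction.postcompCLM A (φ j)) = 0 := by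
    intro A φ hφ
    simp_rw [← hg, Distribution.lineDerivOp_apply_apply, map_neg, lineDeriv_postcomp]
    rw [Finset.sum_neg_distrib, ← map_sum, ← map_sum, hφ, map_zero, map_zero, neg_zero]
  rintro u ⟨φ, hφ, hu⟩
  simp_rw [hu, hNegOne_apply_test]
  rw [Finset.sum_add_distrib, ← Finset.mul_sum]
  have h1 := hdiv RCLike.reCLM φ hφ
  have h2 := hdiv RCLike.imCLM φ hφ
  unfold reTest imTest
  rw [h1, h2, mul_zero, add_zero]

theorem lionsProperty_of_propHc (hconn : IsConnected (Ω : Set (Rn n)))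
    (hbdd : Bornology.IsBounded (Ω : Set (Rn n))) (h : PropHc Ω 𝕜) : LionsProperty Ω 𝕜 := by
  intro F hF
  choose g hg using hF
  obtain ⟨f, hf⟩ := h g (mem_polar_of_distribution hg)
  have hfin : IsFiniteMeasure ((volume : Measure (Rn n)).restrict Ω) :=
    isFiniteMeasure_restrict.2 hbdd.measure_lt_top.ne
  have hint : ∀ (ψ : 𝓓(Ω, ℝ)) (k : LTwo Ω 𝕜),
      Integrable (fun x => ψ x • k x) (volume.restrict (Ω : Set (Rn n))) := fun ψ k =>
    ((Lp.memLp k).integrable one_le_two).smul_of_top_right ψ.memLp_top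
  -- This is `F - f`; the gradients of `F` and `f` coincide, so it vanishes on divergences.
  let T : 𝓓(Ω, ℝ) →ₗ[ℝ] 𝕜 :=
    { toFun := fun ψ => F ψ - ∫ x in (Ω : Set (Rn n)), ψ x • f x
      map_add' := fun φ ψ => by
        have h1 : ∀ x, (φ + ψ) x • f x = φ x • f x + ψ x • f x := fun x => add_smul _ _ _
        simp_rw [h1]
        rw [integral_add (hint _ _) (hint _ _), map_add]
        ring
      map_smul' := fun c ψ => by
        have h1 : ∀ x, (c • ψ) x • f x = c • (ψ x • f x) := fun x => mul_smul _ _ _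
        simp_rw [h1]
        rw [integral_smul, map_smul, RingHom.id_apply, smul_sub] }
  have hT : ∀ Φ, T (divTest Ω Φ) = 0 := by
    intro Φ
    change T (∑ j, ∂_{stdVec j} (Φ j)) = 0
    rw [map_sum]
    refine Finset.sum_eq_zero fun j _ => ?_
    have h1 : (∂_{stdVec j} F : 𝓓'(Ω, 𝕜)) (Φ j) = evalRealTest (g j) (Φ j) := hg j (Φ j)
    rw [hf, evalRealTest_grad, Distribution.lineDerivOp_apply_apply, map_neg, neg_inj] at h1
    exact sub_eq_zero.2 h1
  obtain ⟨c, hc⟩ := exists_eq_integral_smul hconn T hT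
  -- Boundedness of `Ω` gives finite measure, so constants are square integrable and can be absorbed
  -- into `f`.
  have hcL : MemLp (fun _ : Rn n => c) 2 (volume.restrict (Ω : Set (Rn n))) := memLp_const c
  let k : LTwo Ω 𝕜 := hcL.toLp
  refine ⟨f + k, fun ψ => ?_⟩
  have h1 : F ψ = (∫ x in (Ω : Set (Rn n)), ψ x • f x) + (∫ x, ψ x) • c :=
    sub_eq_iff_eq_add'.1 (hc ψ)
  have h2 : ∫ x, ψ x = ∫ x in (Ω : Set (Rn n)), ψ x :=
    (setIntegral_eq_integral_of_forall_compl_eq_zero fun x hx =>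
      image_eq_zero_of_notMem_tsupport fun h => hx (ψ.tsupport_subset h)).symm
  have h3 : ∫ x in (Ω : Set (Rn n)), ψ x • (f + k) x
      = ∫ x in (Ω : Set (Rn n)), (ψ x • f x + ψ x • k x) := by
    refine integral_congr_ae ?_
    filter_upwards [Lp.coeFn_add f k] with x hx
    rw [hx, Pi.add_apply, smul_add]
  have h4 : ∫ x in (Ω : Set (Rn n)), ψ x • k x = ∫ x in (Ω : Set (Rn n)), ψ x • c := by
    refine integral_congr_ae ?_
    filter_upwards [hcL.coeFn_toLp] with x hx
    rw [hx]
  rw [h1, h2, h3, integral_add (hint _ _) (hint _ _), h4, integral_smul_const]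

end Main

end LionsDeRham

end

theorem mainTheorem3 {𝕜 : Type*} [RCLike 𝕜] {n : ℕ}
    (Ω : TopologicalSpace.Opens (EuclideanSpace ℝ (Fin n)))
    (hconn : IsConnected (Ω : Set (EuclideanSpace ℝ (Fin n))))
    (hbdd : Bornology.IsBounded (Ω : Set (EuclideanSpace ℝ (Fin n)))) :
    LionsDeRham.PropHc Ω 𝕜 ↔ LionsDeRham.LionsProperty Ω 𝕜 :=
  ⟨LionsDeRham.lionsProperty_of_propHc hconn hbdd, LionsDeRham.propHc_of_lionsProperty hbdd⟩
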